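/- Logarithms are to base $2$. Let $h(p)=-p\log_2 p-(1-p)\log_2(1-p)$, let $h^{-1}:[0,1]\to[0,1/2]$ be the inverse of the restriction of $h$ to $[0,1/2]$, and for $0\le t\le 1$ put $\eta_t=(1-2h^{-1}(1-t))^2$ and, for $t>0$, $\alpha_t=t/\eta_t$. For a random vector $X^n$ on $\{0,1\}^n$ let $I_{\mathrm{BSC}}^{(t)}(X^n;Y^n)$ (respectively $I_{\mathrm{BEC}}^{(t)}(X^n;Y^n)$) denote the mutual information between $X^n$ and the output $Y^n$ of a memoryless binary symmetric (respectively binary erasure) channel with capacity $t$, used once for each coordinate. Then $\eta_t$ is the strong data processing (SDPI) coefficient of the binary symmetric channel $P_{Y|X}$ with capacity $t$, that is, $\eta_t=\sup I(U;Y)/I(U;X)$, the supremum being over all pairs $(U,X)$, $U$ with a finite alphabet, $X$ binary and $I(U;X)>0$, where $U-X-Y$ is a Markov chain. Moreover, let $C\subset\{0,1\}^n$ be a (binary) linear code, $u\in\{0,1\}^n$, and let $X^n$ be uniformly distributed on $C+u$. Then for every $t\in[0,1]$ $$I_{\mathrm{BSC}}^{(t)}(X^n;Y^n)\ \ge\ t\cdot\frac{I_{\mathrm{BEC}}^{(\eta_t)}(X^n;Y^n)}{\eta_t}=\alpha_t\cdot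 I_{\mathrm{BEC}}^{(\eta_t)}(X^n;Y^n),$$ where for $t=0$ (when $\eta_t=0$ and all these mutual informations vanish) both expressions on the right are read as $0$. -/

import Mathlib

open scoped BigOperators

noncomputable section

namespace CodeInfo

/-- Binary entropy function in bits: `h p = -p log₂ p - (1-p) log₂ (1-p)`. -/
def h (p : ℝ) : ℝ := Real.binEntropy p / Real.log 2

/-- The inverse of the restriction of `h` to `[0, 1/2]`; meaningful on `[0, 1]`. -/
def hinv (y : ℝ) : ℝ := Function.invFunOn h (Set.Icc 0 (1 / 2)) y

/-- `η_t = (1 - 2 h⁻¹(1 - t))²`. -/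
def eta (t : ℝ) : ℝ := (1 - 2 * hinv (1 - t)) ^ 2

/-- `α_t = t / η_t`. -/
def alpha (t : ℝ) : ℝ := t / eta t

/-- Mutual information `I(A;B)` in bits of a pair `(A, B)` with finite alphabets and joint
probability mass function `q`. Terms with `q a b = 0` contribute `0`. -/
def mutualInfo {α β : Type} [Fintype α] [Fintype β] (q : α → β → ℝ) : ℝ :=
  ∑ a, ∑ b, q a b * Real.logb 2 (q a b / ((∑ b', q a b') * (∑ a', q a' b)))

/-- Mutual information between an input with mass function `P` and the output of the channel with
transition probabilities `W`. -/
def channelInfo {α β : Type} [Fintype α] [Fintype β] (P : α → ℝ) (W : α → β → ℝ) : ℝ :=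
  mutualInfo (fun a b => P a * W a b)

/-- `c` is the capacity of the channel `W`: the supremum over all input distributions of the
mutual information between input and output. -/
def HasCapacity {α β : Type} [Fintype α] [Fintype β] (W : α → β → ℝ) (c : ℝ) : Prop :=
  IsLUB {r : ℝ | ∃ P ∈ stdSimplex ℝ α, r = channelInfo P W} c

/-- `s` is the strong data processing (SDPI) coefficient of the channel `W` from `X` to `Y`: the
supremum of `I(U;Y) / I(U;X)` over all joint laws `P` of `(U, X)` with `I(U;X) > 0`, where
`U - X - Y` is a Markov chain. -/
def IsSDPICoeff {α β : Type} [Fintype α] [Fintype β] (W : α → β → ℝ) (s : ℝ) : Prop :=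
  IsLUB {r : ℝ | ∃ (k : ℕ) (P : Fin k × α → ℝ), P ∈ stdSimplex ℝ (Fin k × α) ∧
    0 < mutualInfo (fun u x => P (u, x)) ∧
    r = mutualInfo (fun u y => ∑ x, P (u, x) * W x y) / mutualInfo (fun u x => P (u, x))} s

/-- Binary symmetric channel with crossover probability `p`. -/
def bsc (p : ℝ) (x y : ZMod 2) : ℝ := if y = x then 1 - p else p

/-- Binary erasure channel with erasure probability `e`; the output `none` is the erasure. -/
def bec (e : ℝ) (x : ZMod 2) : Option (ZMod 2) → ℝ
  | none => e
  | some y => if y = x then 1 - e else 0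

/-- The memoryless extension `W^{⊗ n}` of a channel `W`. -/
def memoryless {α β : Type} (n : ℕ) (W : α → β → ℝ) (x : Fin n → α) (y : Fin n → β) : ℝ :=
  ∏ i, W (x i) (y i)

/-- Mass function of the uniform distribution on a finite set `S`. -/
def uniformOn {α : Type} (S : Set α) : α → ℝ := S.indicator (fun _ => 1 / (S.ncard : ℝ))

/-- The shifted linear code `C + u`. -/
def shiftedCode {n : ℕ} (C : Submodule (ZMod 2) (Fin n → ZMod 2)) (u : Fin n → ZMod 2) :
    Set (Fin n → ZMod 2) := (fun c => c + u) '' (C : Set (Fin n → ZMod 2))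

end CodeInfo

end

noncomputable section

namespace CodeInfo

open Real Finset

/-! ### The entropy gap and the splitting entropy -/

-- Write c = 1 - 2p for the crossover probability p of the BSC. The capacity conditions force η = c²
-- and make the BEC deliver each bit with probability c².
--
-- The coding inequality follows by revealing the coordinates one at a time. Given the outputs of
-- the other coordinates, let d be the conditional bias of the next input bit. Through the BSC this
-- bit yields at least (log 2 - `binEntropy p`)(1 - d²) nats, because the entropy gap is a power
-- series in x² with nonnegative coefficients and no constant term (`entropyGap_mul_le`). Through
-- the BEC it yields exactly c² log 2 (1 - d²): for an affine code the bit is either determined or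
-- unbiased, so d is 0 or ±1 (`TranslationInvariant.bec_trichotomy`). The mean of d² is a chi-square
-- functional, and it is at most as large behind the BSC as behind the BEC (`chiSq_bsc_le_bec`).
-- Summing 1 - E d², taken behind the BEC, over the coordinates gives a number K with I_BEC = ηK and
-- I_BSC ≥ tK.
--
-- For the SDPI coefficient, the upper bound is Jensen's inequality for `convexOn_binEntropy_noise`;
-- the lower bound lets the bias of a symmetric pair tend to 0.

/-- The divergence (in nats) between a bit of bias `x` and an unbiased bit. -/
def entropyGap (x : ℝ) : ℝ := log 2 - binEntropy ((1 + x) / 2)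

lemma continuous_entropyGap : Continuous entropyGap := by
  unfold entropyGap; fun_prop

lemma entropyGap_neg (x : ℝ) : entropyGap (-x) = entropyGap x := by
  unfold entropyGap
  rw [← binEntropy_one_sub, show 1 - (1 + -x) / 2 = (1 + x) / 2 by ring]

/-- The coefficient is 1/(2k+1) - 1/(2k+2): the two terms come from the series of log(1+x) -
log(1-x) and of -log(1-x²). -/
lemma hasSum_entropyGap {x : ℝ} (hx : |x| < 1) :
    HasSum (fun k : ℕ => x ^ (2 * k + 2) / ((2 * k + 1) * (2 * k + 2))) (entropyGap x) := by
  have hx2 : |x ^ 2| < 1 := by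
    rw [abs_pow]; exact pow_lt_one₀ (abs_nonneg _) hx two_ne_zero
  have h1 := (hasSum_log_sub_log_of_abs_lt_one hx).mul_left (x / 2)
  have h2 := (hasSum_pow_div_log_of_abs_lt_one hx2).mul_left (1 / 2)
  obtain ⟨hl, hr⟩ := abs_lt.1 hx
  have hp : (1 + x) ≠ 0 := by linarith
  have hm : (1 - x) ≠ 0 := by linarith
  have key : entropyGap x
      = x / 2 * (log (1 + x) - log (1 - x)) - 1 / 2 * (-log (1 - x ^ 2)) := by
    rw [entropyGap, binEntropy_eq_negMulLog_add_negMulLog_one_sub,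
      show 1 - (1 + x) / 2 = (1 - x) / 2 by ring, negMulLog, negMulLog,
      log_div hp two_ne_zero, log_div hm two_ne_zero,
      show 1 - x ^ 2 = (1 + x) * (1 - x) by ring, log_mul hp hm]
    ring
  rw [key]
  refine (h1.sub h2).congr_fun ?_
  intro k
  have e1 : (2 * (k : ℝ) + 1) ≠ 0 := by positivity
  have e2 : ((k : ℝ) + 1) ≠ 0 := by positivity
  have e3 : (2 * (k : ℝ) + 2) ≠ 0 := by positivity
  field_simp
  ring

lemma half_sq_le_entropyGap {x : ℝ} (hx : |x| < 1) : x ^ 2 / 2 ≤ entropyGap x := by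
  have h := (hasSum_entropyGap hx)
  have := h.summable.sum_le_tsum {0} (fun k _ => by
    rw [show 2 * k + 2 = 2 * (k + 1) by ring, pow_mul]; positivity)
  rw [h.tsum_eq] at this
  simpa using this

lemma entropyGap_le {x : ℝ} (hx : |x| < 1) : entropyGap x ≤ x ^ 2 / 2 / (1 - x ^ 2) := by
  have hx2 : x ^ 2 < 1 := (sq_lt_one_iff_abs_lt_one x).2 hx
  have hg := (hasSum_geometric_of_lt_one (sq_nonneg x) hx2).mul_left (x ^ 2 / 2)
  refine hasSum_le (fun k => ?_) (hasSum_entropyGap hx) hg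
  rw [show x ^ (2 * k + 2) = x ^ 2 * (x ^ 2) ^ k by ring, div_le_iff₀ (by positivity)]
  have h1 : (2 : ℝ) ≤ (2 * k + 1) * (2 * k + 2) := by
    have : (0 : ℝ) ≤ k := by positivity
    nlinarith
  have h2 : 0 ≤ x ^ 2 * (x ^ 2) ^ k := by positivity
  nlinarith

/-- Termwise, d^(2k+2) ≤ d². The endpoints |c| = 1, which noiseless channels need, follow by
continuity. -/
lemma entropyGap_mul_le {c d : ℝ} (hc : |c| ≤ 1) (hd : |d| ≤ 1) :
    entropyGap (c * d) ≤ d ^ 2 * entropyGap c := by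
  have hopen : ∀ c ∈ Set.Ioo (-1 : ℝ) 1, entropyGap (c * d) ≤ d ^ 2 * entropyGap c := by
    intro c hc
    have hc1 : |c| < 1 := abs_lt.2 hc
    have hcd : |c * d| < 1 := by
      rw [abs_mul]
      exact (mul_le_of_le_one_right (abs_nonneg _) hd).trans_lt hc1
    refine hasSum_le (fun k => ?_) (hasSum_entropyGap hcd)
      ((hasSum_entropyGap hc1).mul_left (d ^ 2))
    have hd2 : d ^ 2 ≤ 1 := (sq_le_one_iff_abs_le_one d).2 hd
    have h1 : (d ^ 2) ^ k ≤ 1 := pow_le_one₀ (sq_nonneg d) hd2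
    rw [← mul_div_assoc]
    gcongr
    rw [show (c * d) ^ (2 * k + 2) = (d ^ 2 * (c ^ 2) ^ (k + 1)) * (d ^ 2) ^ k by ring,
      show d ^ 2 * c ^ (2 * k + 2) = d ^ 2 * (c ^ 2) ^ (k + 1) by ring]
    exact mul_le_of_le_one_right (by positivity) h1
  have hmem : c ∈ closure (Set.Ioo (-1 : ℝ) 1) := by
    rw [closure_Ioo (by norm_num)]; exact abs_le.1 hc
  exact le_on_closure hopen
    (by have := continuous_entropyGap; fun_prop) (by have := continuous_entropyGap; fun_prop) hmem

/-- The entropy of splitting a mass `r + s` into `r` and `s`, in nats. -/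
def splitEntropy (r s : ℝ) : ℝ := negMulLog r + negMulLog s - negMulLog (r + s)

lemma splitEntropy_eq {r s : ℝ} (hr : 0 ≤ r) (hs : 0 ≤ s) :
    splitEntropy r s = (r + s) * binEntropy (s / (r + s)) := by
  rcases eq_or_ne (r + s) 0 with h | h
  · have h1 : r = 0 := by linarith
    have h2 : s = 0 := by linarith
    simp [splitEntropy, h1, h2]
  · have h1 := negMulLog_mul (r + s) (s / (r + s))
    have h2 := negMulLog_mul (r + s) (1 - s / (r + s))
    rw [mul_div_cancel₀ _ h] at h1
    rw [mul_sub, mul_one, mul_div_cancel₀ _ h, add_sub_cancel_right] at h2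
    rw [splitEntropy, h1, h2, binEntropy_eq_negMulLog_add_negMulLog_one_sub]
    ring

/-- The noise moves a to a point b nearer 1/2, so b(1-b) ≥ a(1-a). The second derivative is (1-2p)²
(1/(a(1-a)) - 1/(b(1-b))). -/
lemma convexOn_binEntropy_noise {p : ℝ} (hp : p ∈ Set.Icc (0 : ℝ) 1) :
    ConvexOn ℝ (Set.Icc (0 : ℝ) 1)
      (fun a => binEntropy (p + (1 - 2 * p) * a) - (1 - 2 * p) ^ 2 * binEntropy a) := by
  obtain ⟨hp0, hp1⟩ := hp
  have hb : ∀ a ∈ Set.Ioo (0 : ℝ) 1, 0 < p + (1 - 2 * p) * a ∧ p + (1 - 2 * p) * a < 1 := by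
    rintro a ⟨h0, h1⟩
    constructor <;> rcases lt_or_ge p (1 / 2) with h | h <;> nlinarith
  refine convexOn_of_hasDerivWithinAt2_nonneg (convex_Icc 0 1)
    (f' := fun a => (1 - 2 * p) * (log (1 - (p + (1 - 2 * p) * a)) - log (p + (1 - 2 * p) * a))
      - (1 - 2 * p) ^ 2 * (log (1 - a) - log a))
    (f'' := fun a => (1 - 2 * p) ^ 2 *
      ((1 / (1 - a) + 1 / a) - (1 / (1 - (p + (1 - 2 * p) * a)) + 1 / (p + (1 - 2 * p) * a))))
    (by fun_prop) ?_ ?_ ?_ <;> rw [interior_Icc] <;> intro a ha <;>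
    obtain ⟨hb0, hb1⟩ := hb a ha <;> obtain ⟨ha0, ha1⟩ := ha
  · have hl : HasDerivAt (fun a : ℝ => p + (1 - 2 * p) * a) (1 - 2 * p) a := by
      simpa using ((hasDerivAt_id a).const_mul (1 - 2 * p)).const_add p
    have h1 := (hasDerivAt_binEntropy hb0.ne' hb1.ne).comp a hl
    have h2 := (hasDerivAt_binEntropy ha0.ne' ha1.ne).const_mul ((1 - 2 * p) ^ 2)
    refine ((h1.sub h2).congr_deriv ?_).hasDerivWithinAt
    ring
  · have hl : HasDerivAt (fun a : ℝ => p + (1 - 2 * p) * a) (1 - 2 * p) a := by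
      simpa using ((hasDerivAt_id a).const_mul (1 - 2 * p)).const_add p
    have h1 := ((hl.const_sub 1).log (by linarith)).sub (hl.log hb0.ne')
    have h2 := (((hasDerivAt_id a).const_sub 1).log (by simp; linarith)).sub
      ((hasDerivAt_id a).log ha0.ne')
    refine (((h1.const_mul (1 - 2 * p)).sub (h2.const_mul ((1 - 2 * p) ^ 2))).congr_deriv
      ?_).hasDerivWithinAt
    simp only [id]
    ring
  · set b := p + (1 - 2 * p) * a with hbdef
    have e : ∀ x : ℝ, 0 < x → x < 1 → 1 / (1 - x) + 1 / x = 1 / (x * (1 - x)) := by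
      intro x h0 h1
      have : 1 - x ≠ 0 := by linarith
      field_simp
      ring
    rw [e a ha0 ha1, e b hb0 hb1]
    refine mul_nonneg (sq_nonneg _) (sub_nonneg.2 ?_)
    refine one_div_le_one_div_of_le (mul_pos ha0 (by linarith)) ?_
    have : b * (1 - b) - a * (1 - a) = p * (1 - p) * (1 - 2 * a) ^ 2 := by
      rw [hbdef]; ring
    nlinarith [mul_nonneg (mul_nonneg hp0 (sub_nonneg.2 hp1)) (sq_nonneg (1 - 2 * a))]

/-! ### Mutual information through entropies -/

/-- I = H(A) + H(B) - H(A,B) in nats. Nonnegativity makes both marginals positive wherever `q a b`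
is, so the logarithm splits. -/
lemma mutualInfo_mul_log_two {α β : Type} [Fintype α] [Fintype β] {q : α → β → ℝ}
    (hq : ∀ a b, 0 ≤ q a b) :
    mutualInfo q * log 2 = ∑ a, negMulLog (∑ b, q a b) + ∑ b, negMulLog (∑ a, q a b)
      - ∑ a, ∑ b, negMulLog (q a b) := by
  have hterm : ∀ a b, q a b * logb 2 (q a b / ((∑ b', q a b') * (∑ a', q a' b))) * log 2
      = -(q a b * log (∑ b', q a b')) - q a b * log (∑ a', q a' b) - negMulLog (q a b) := by
    intro a b
    rcases eq_or_lt_of_le (hq a b) with h | h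
    · simp [← h]
    · have h1 : 0 < ∑ b', q a b' :=
        sum_pos' (fun b' _ => hq a b') ⟨b, mem_univ _, h⟩
      have h2 : 0 < ∑ a', q a' b :=
        sum_pos' (fun a' _ => hq a' b) ⟨a, mem_univ _, h⟩
      have hl : log 2 ≠ 0 := (log_pos one_lt_two).ne'
      rw [logb, mul_assoc, div_mul_cancel₀ _ hl, log_div h.ne' (mul_pos h1 h2).ne',
        log_mul h1.ne' h2.ne', negMulLog]
      ring
  have hsum : mutualInfo q * log 2 = ∑ a, ∑ b, (-(q a b * log (∑ b', q a b'))
      - q a b * log (∑ a', q a' b) - negMulLog (q a b)) := by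
    rw [mutualInfo, sum_mul]
    refine sum_congr rfl fun a _ => ?_
    rw [sum_mul]
    exact sum_congr rfl fun b _ => hterm a b
  rw [hsum]
  simp only [sum_sub_distrib, sum_neg_distrib]
  rw [sum_comm (f := fun a b => q a b * log (∑ a', q a' b))]
  simp only [← sum_mul, negMulLog, neg_mul, sum_neg_distrib]
  ring

lemma sum_zmod_two (f : ZMod 2 → ℝ) : ∑ x, f x = f 0 + f 1 := Fin.sum_univ_two f

/-- Output mass function of the channel `W` with input mass function `P`. -/
def output {α β : Type} [Fintype α] (W : α → β → ℝ) (P : α → ℝ) (y : β) : ℝ :=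
  ∑ x, P x * W x y

lemma channelInfo_mul_log_two {α β : Type} [Fintype α] [Fintype β] {P : α → ℝ} {W : α → β → ℝ}
    {H : ℝ} (hP : P ∈ stdSimplex ℝ α) (hW : ∀ x y, 0 ≤ W x y) (hW1 : ∀ x, ∑ y, W x y = 1)
    (hH : ∀ x, ∑ y, negMulLog (W x y) = H) :
    channelInfo P W * log 2 = ∑ y, negMulLog (output W P y) - H := by
  rw [channelInfo, mutualInfo_mul_log_two (fun a b => mul_nonneg (hP.1 a) (hW a b))]
  simp only [negMulLog_mul, sum_add_distrib, ← mul_sum, ← sum_mul, hW1, hH, hP.2, mul_one, one_mul,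
    output]
  ring

/-! ### The two channels and their capacities -/

lemma bsc_nonneg {p : ℝ} (hp : p ∈ Set.Icc (0 : ℝ) 1) (x y : ZMod 2) : 0 ≤ bsc p x y := by
  unfold bsc; split_ifs <;> linarith [hp.1, hp.2]

lemma bec_nonneg {e : ℝ} (he : e ∈ Set.Icc (0 : ℝ) 1) (x : ZMod 2) (y : Option (ZMod 2)) :
    0 ≤ bec e x y := by
  cases y with
  | none => exact he.1
  | some y => simp only [bec]; split_ifs <;> linarith [he.2]

@[simp] lemma bsc_zero_zero (p : ℝ) : bsc p 0 0 = 1 - p := by simp [bsc]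
@[simp] lemma bsc_one_one (p : ℝ) : bsc p 1 1 = 1 - p := by simp [bsc]
@[simp] lemma bsc_zero_one (p : ℝ) : bsc p 0 1 = p := by simp [bsc]
@[simp] lemma bsc_one_zero (p : ℝ) : bsc p 1 0 = p := by simp [bsc]
@[simp] lemma bec_none (e : ℝ) (x : ZMod 2) : bec e x none = e := rfl
@[simp] lemma bec_zero_zero (e : ℝ) : bec e 0 (some 0) = 1 - e := by simp [bec]
@[simp] lemma bec_one_one (e : ℝ) : bec e 1 (some 1) = 1 - e := by simp [bec]
@[simp] lemma bec_zero_one (e : ℝ) : bec e 0 (some 1) = 0 := by simp [bec]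
@[simp] lemma bec_one_zero (e : ℝ) : bec e 1 (some 0) = 0 := by simp [bec]

lemma sum_bsc {p : ℝ} {f : ℝ → ℝ} (x : ZMod 2) : ∑ y, f (bsc p x y) = f (1 - p) + f p := by
  rw [sum_zmod_two]
  fin_cases x
  · change f (bsc p 0 0) + f (bsc p 0 1) = _
    simp
  · change f (bsc p 1 0) + f (bsc p 1 1) = _
    simp [add_comm]

lemma sum_bec {e : ℝ} {f : ℝ → ℝ} (hf : f 0 = 0) (x : ZMod 2) :
    ∑ y, f (bec e x y) = f (1 - e) + f e := by
  rw [Fintype.sum_option, sum_zmod_two]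
  fin_cases x
  · change f (bec e 0 none) + (f (bec e 0 (some 0)) + f (bec e 0 (some 1))) = _
    simp [hf, add_comm]
  · change f (bec e 1 none) + (f (bec e 1 (some 0)) + f (bec e 1 (some 1))) = _
    simp [hf, add_comm]

lemma sum_bsc_row (p : ℝ) (x : ZMod 2) : ∑ y, bsc p x y = 1 := by
  simpa using sum_bsc (p := p) (f := id) x

lemma sum_bec_row (e : ℝ) (x : ZMod 2) : ∑ y, bec e x y = 1 := by
  simpa using sum_bec (e := e) (f := id) rfl x

lemma sum_negMulLog_bsc (p : ℝ) (x : ZMod 2) : ∑ y, negMulLog (bsc p x y) = binEntropy p := by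
  rw [sum_bsc, binEntropy_eq_negMulLog_add_negMulLog_one_sub, add_comm]

lemma sum_negMulLog_bec (e : ℝ) (x : ZMod 2) : ∑ y, negMulLog (bec e x y) = binEntropy e := by
  rw [sum_bec negMulLog_zero, binEntropy_eq_negMulLog_add_negMulLog_one_sub, add_comm]

lemma log_two_pos : 0 < log 2 := log_pos one_lt_two

/-- The output of the BSC on input masses `r, s`. -/
lemma splitEntropy_bsc {p r s : ℝ} (hp : p ∈ Set.Icc (0 : ℝ) 1) (hr : 0 ≤ r) (hs : 0 ≤ s) :
    splitEntropy ((1 - p) * r + p * s) (p * r + (1 - p) * s)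
      = (r + s) * binEntropy (p + (1 - 2 * p) * (s / (r + s))) := by
  have h1 : 0 ≤ 1 - p := by linarith [hp.2]
  have h0 := hp.1
  rw [splitEntropy_eq (by positivity) (by positivity),
    show (1 - p) * r + p * s + (p * r + (1 - p) * s) = r + s by ring]
  rcases eq_or_ne (r + s) 0 with h | h
  · simp [h]
  · congr 2
    field_simp
    ring

lemma mem_stdSimplex_zmod_two {P : ZMod 2 → ℝ} (hP : P ∈ stdSimplex ℝ (ZMod 2)) :
    0 ≤ P 0 ∧ 0 ≤ P 1 ∧ P 0 + P 1 = 1 :=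
  ⟨hP.1 0, hP.1 1, by rw [← sum_zmod_two]; exact hP.2⟩

lemma const_half_mem_stdSimplex : (fun _ => 1 / 2 : ZMod 2 → ℝ) ∈ stdSimplex ℝ (ZMod 2) :=
  ⟨fun _ => by norm_num, by rw [sum_zmod_two]; norm_num⟩

lemma channelInfo_bsc {p : ℝ} (hp : p ∈ Set.Icc (0 : ℝ) 1) {P : ZMod 2 → ℝ}
    (hP : P ∈ stdSimplex ℝ (ZMod 2)) :
    channelInfo P (bsc p) * log 2 = binEntropy (p + (1 - 2 * p) * P 1) - binEntropy p := by
  rw [channelInfo_mul_log_two hP (bsc_nonneg hp) (sum_bsc_row p) (sum_negMulLog_bsc p)]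
  obtain ⟨h0, h1, hs⟩ := mem_stdSimplex_zmod_two hP
  have := splitEntropy_bsc hp h0 h1
  rw [splitEntropy, hs, one_mul, div_one,
    show (1 - p) * P 0 + p * P 1 + (p * P 0 + (1 - p) * P 1) = P 0 + P 1 by ring, hs,
    negMulLog_one, sub_zero] at this
  rw [← this]
  simp only [output, sum_zmod_two, bsc_zero_zero, bsc_one_one, bsc_zero_one, bsc_one_zero]
  ring_nf

lemma capacity_bsc {p t : ℝ} (hp : p ∈ Set.Icc (0 : ℝ) 1) (h : HasCapacity (bsc p) t) :
    t * log 2 = log 2 - binEntropy p := by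
  have key : IsLUB {r : ℝ | ∃ P ∈ stdSimplex ℝ (ZMod 2), r = channelInfo P (bsc p)}
      ((log 2 - binEntropy p) / log 2) := by
    refine IsGreatest.isLUB ⟨⟨_, const_half_mem_stdSimplex, ?_⟩, ?_⟩
    · rw [div_eq_iff log_two_pos.ne', channelInfo_bsc hp const_half_mem_stdSimplex,
        show p + (1 - 2 * p) * (1 / 2) = 2⁻¹ by ring, binEntropy_two_inv]
    · rintro r ⟨P, hP, rfl⟩
      rw [le_div_iff₀ log_two_pos, channelInfo_bsc hp hP]
      exact sub_le_sub_right binEntropy_le_log_two _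
  rw [h.unique key, div_mul_cancel₀ _ log_two_pos.ne']

/-- Erasure is visible in the output and independent of the input, so its entropy separates; the
remaining fraction 1 - e reveals the split. -/
lemma splitEntropy_bec (e r s : ℝ) :
    negMulLog (e * (r + s)) + (negMulLog ((1 - e) * r) + negMulLog ((1 - e) * s))
      = negMulLog (r + s) + (r + s) * binEntropy e + (1 - e) * splitEntropy r s := by
  simp only [negMulLog_mul, splitEntropy, binEntropy_eq_negMulLog_add_negMulLog_one_sub]
  ring

lemma channelInfo_bec {e : ℝ} (he : e ∈ Set.Icc (0 : ℝ) 1) {P : ZMod 2 → ℝ}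
    (hP : P ∈ stdSimplex ℝ (ZMod 2)) :
    channelInfo P (bec e) * log 2 = (1 - e) * binEntropy (P 1) := by
  rw [channelInfo_mul_log_two hP (bec_nonneg he) (sum_bec_row e) (sum_negMulLog_bec e)]
  obtain ⟨h0, h1, hs⟩ := mem_stdSimplex_zmod_two hP
  have h := splitEntropy_bec e (P 0) (P 1)
  rw [splitEntropy_eq h0 h1, hs, one_mul, div_one, mul_one, one_mul, negMulLog_one, zero_add] at h
  rw [sub_eq_iff_eq_add, add_comm, ← h]
  simp only [output, Fintype.sum_option, sum_zmod_two, bec_none, bec_zero_zero, bec_one_one,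
    bec_zero_one, bec_one_zero, ← add_mul, hs]
  ring_nf

lemma capacity_bec {e s : ℝ} (he : e ∈ Set.Icc (0 : ℝ) 1) (h : HasCapacity (bec e) s) :
    s = 1 - e := by
  refine h.unique (IsGreatest.isLUB ⟨⟨_, const_half_mem_stdSimplex, ?_⟩, ?_⟩)
  · have := channelInfo_bec he const_half_mem_stdSimplex
    rw [one_div, binEntropy_two_inv] at this
    rw [one_div]
    exact (mul_right_cancel₀ log_two_pos.ne' this).symm
  · rintro r ⟨P, hP, rfl⟩
    refine le_of_mul_le_mul_right ?_ log_two_pos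
    rw [channelInfo_bec he hP]
    exact mul_le_mul_of_nonneg_left binEntropy_le_log_two (by linarith [he.2])

/-- The capacity fixes p only up to p ↦ 1 - p, under which the square is unchanged. -/
lemma eta_eq_of_capacity {p t : ℝ} (hp : p ∈ Set.Icc (0 : ℝ) 1)
    (ht : t * log 2 = log 2 - binEntropy p) : eta t = (1 - 2 * p) ^ 2 := by
  have hinj : Set.InjOn h (Set.Icc 0 (1 / 2)) := by
    intro x hx y hy hxy
    rw [one_div] at hx hy
    refine binEntropy_strictMonoOn.injOn hx hy ?_
    simpa [h, div_left_inj' log_two_pos.ne'] using hxy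
  have hh : ∀ q, binEntropy q = binEntropy p → q ∈ Set.Icc (0 : ℝ) (1 / 2) →
      hinv (1 - t) = q := by
    intro q hq hmem
    have : 1 - t = h q := by
      rw [h, eq_div_iff log_two_pos.ne', hq]; linarith
    rw [hinv, this]
    have hex : ∃ a ∈ Set.Icc (0 : ℝ) (1 / 2), h a = h q := ⟨q, hmem, rfl⟩
    exact hinj (Function.invFunOn_mem hex) hmem (Function.invFunOn_eq hex)
  rcases le_total p (1 / 2) with h2 | h2
  · rw [eta, hh p rfl ⟨hp.1, h2⟩]
  · rw [eta, hh (1 - p) (binEntropy_one_sub p) ⟨by linarith [hp.2], by linarith⟩]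
    ring

/-! ### The SDPI coefficient of the binary symmetric channel -/

lemma mutualInfo_binary {k : ℕ} {q : Fin k → ZMod 2 → ℝ} (hq : ∀ a b, 0 ≤ q a b)
    (hq1 : ∑ a, ∑ b, q a b = 1) :
    mutualInfo q * log 2 = splitEntropy (∑ a, q a 0) (∑ a, q a 1)
      - ∑ a, splitEntropy (q a 0) (q a 1) := by
  rw [mutualInfo_mul_log_two hq]
  simp only [sum_zmod_two, splitEntropy, sum_add_distrib, sum_sub_distrib] at hq1 ⊢
  rw [hq1, negMulLog_one]
  ring

lemma mutualInfo_bsc_le {p : ℝ} (hp : p ∈ Set.Icc (0 : ℝ) 1) {k : ℕ} {P : Fin k × ZMod 2 → ℝ}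
    (hP : P ∈ stdSimplex ℝ (Fin k × ZMod 2)) :
    mutualInfo (fun u y => ∑ x, P (u, x) * bsc p x y)
      ≤ (1 - 2 * p) ^ 2 * mutualInfo (fun u x => P (u, x)) := by
  have hsum : ∑ u, (P (u, 0) + P (u, 1)) = 1 := by
    rw [← hP.2, Fintype.sum_prod_type]; simp only [sum_zmod_two]
  have h0 : ∀ u x, 0 ≤ P (u, x) := fun u x => hP.1 _
  refine le_of_mul_le_mul_right ?_ log_two_pos
  rw [mul_assoc, mutualInfo_binary (fun a b => sum_nonneg fun x _ => mul_nonneg (h0 _ _)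
    (bsc_nonneg hp _ _)), mutualInfo_binary h0]
  rotate_left
  · simpa only [sum_zmod_two] using hsum
  · rw [← hsum]
    refine sum_congr rfl fun u _ => ?_
    simp only [sum_zmod_two, bsc_zero_zero, bsc_one_one, bsc_zero_one, bsc_one_zero]
    ring
  -- Jensen over the posteriors P(X=1|U=u). A value u of zero mass has posterior 0/0 = 0 and weight
  -- 0.
  have hJ := (convexOn_binEntropy_noise hp).map_sum_le (t := univ)
    (w := fun u => P (u, 0) + P (u, 1)) (p := fun u => P (u, 1) / (P (u, 0) + P (u, 1)))
    (fun u _ => add_nonneg (h0 _ _) (h0 _ _)) hsum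
    (fun u _ => ⟨div_nonneg (h0 _ _) (add_nonneg (h0 _ _) (h0 _ _)),
      div_le_one_of_le₀ (by linarith [h0 u 0]) (add_nonneg (h0 _ _) (h0 _ _))⟩)
  have hmean : ∀ u, (P (u, 0) + P (u, 1)) * (P (u, 1) / (P (u, 0) + P (u, 1))) = P (u, 1) := by
    intro u
    refine mul_div_cancel_of_imp' fun h => ?_
    linarith [h0 u 0, h0 u 1]
  simp only [smul_eq_mul, hmean, mul_sub] at hJ
  have hpush : ∀ r s : ℝ, 0 ≤ r → 0 ≤ s →
      splitEntropy (r * (1 - p) + s * p) (r * p + s * (1 - p))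
        = (r + s) * binEntropy (p + (1 - 2 * p) * (s / (r + s))) := by
    intro r s hr hs
    rw [← splitEntropy_bsc hp hr hs]
    ring_nf
  simp only [sum_zmod_two, bsc_zero_zero, bsc_one_one, bsc_zero_one, bsc_one_zero]
  have hA : ∑ u, (P (u, 0) * (1 - p) + P (u, 1) * p)
      = (∑ u, P (u, 0)) * (1 - p) + (∑ u, P (u, 1)) * p := by
    simp only [sum_add_distrib, sum_mul]
  have hB : ∑ u, (P (u, 0) * p + P (u, 1) * (1 - p))
      = (∑ u, P (u, 0)) * p + (∑ u, P (u, 1)) * (1 - p) := by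
    simp only [sum_add_distrib, sum_mul]
  have hs0 : 0 ≤ ∑ u, P (u, 0) := sum_nonneg fun u _ => h0 _ _
  have hs1 : 0 ≤ ∑ u, P (u, 1) := sum_nonneg fun u _ => h0 _ _
  rw [sum_add_distrib] at hsum
  rw [hA, hB, hpush _ _ hs0 hs1, splitEntropy_eq hs0 hs1, hsum, one_mul, div_one, one_mul]
  simp only [hpush _ _ (h0 _ _) (h0 _ _), splitEntropy_eq (h0 _ _) (h0 _ _)]
  rw [sum_sub_distrib] at hJ
  have hE : ∑ u, (P (u, 0) + P (u, 1)) *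
      ((1 - 2 * p) ^ 2 * binEntropy (P (u, 1) / (P (u, 0) + P (u, 1))))
      = (1 - 2 * p) ^ 2 * ∑ u, (P (u, 0) + P (u, 1)) *
        binEntropy (P (u, 1) / (P (u, 0) + P (u, 1))) := by
    rw [mul_sum]; exact sum_congr rfl fun u _ => by ring
  rw [hE] at hJ
  linarith

/-- Uniform bit `U` seen through a symmetric channel of bias `x`. -/
def symmetricPair (x : ℝ) (v : Fin 2 × ZMod 2) : ℝ :=
  if ((v.1 : ℕ) : ZMod 2) = v.2 then (1 + x) / 4 else (1 - x) / 4

lemma mutualInfo_symmetric {x : ℝ} (hx : |x| ≤ 1) {q : Fin 2 → ZMod 2 → ℝ}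
    (h00 : q 0 0 = (1 + x) / 4) (h01 : q 0 1 = (1 - x) / 4) (h10 : q 1 0 = (1 - x) / 4)
    (h11 : q 1 1 = (1 + x) / 4) : mutualInfo q * log 2 = entropyGap x := by
  obtain ⟨hl, hr⟩ := abs_le.1 hx
  have hp : 0 ≤ (1 + x) / 4 := by linarith
  have hm : 0 ≤ (1 - x) / 4 := by linarith
  rw [mutualInfo_binary]
  · simp only [Fin.sum_univ_two, h00, h01, h10, h11]
    rw [splitEntropy_eq (by linarith) (by linarith), splitEntropy_eq hp hm, splitEntropy_eq hm hp,
      entropyGap]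
    rw [show (1 + x) / 4 + (1 - x) / 4 = 1 / 2 by ring,
      show (1 - x) / 4 + (1 + x) / 4 = 1 / 2 by ring,
      show (1 - x) / 4 / (1 / 2) = 1 - (1 + x) / 2 by ring,
      show (1 + x) / 4 / (1 / 2) = (1 + x) / 2 by ring, binEntropy_one_sub,
      show (1 / 2 : ℝ) / (1 / 2 + 1 / 2) = 2⁻¹ by norm_num, binEntropy_two_inv]
    ring
  · intro a b
    fin_cases a <;> fin_cases b
    · exact h00 ▸ hp
    · exact h01 ▸ hm
    · exact h10 ▸ hm
    · exact h11 ▸ hp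
  · simp only [Fin.sum_univ_two, sum_zmod_two, h00, h01, h10, h11]
    ring

lemma isSDPICoeff_bsc {p : ℝ} (hp : p ∈ Set.Icc (0 : ℝ) 1) :
    IsSDPICoeff (bsc p) ((1 - 2 * p) ^ 2) := by
  have hc : |1 - 2 * p| ≤ 1 := abs_le.2 ⟨by linarith [hp.2], by linarith [hp.1]⟩
  refine ⟨?_, ?_⟩
  · rintro r ⟨k, P, hP, hpos, rfl⟩
    exact (div_le_iff₀ hpos).2 (mutualInfo_bsc_le hp hP)
  · intro s hs
    -- A pair of bias x has ratio `entropyGap (c x) / entropyGap x` with c = 1 - 2p. The quadratic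
    -- bounds on both gaps leave the factor 1 - x², which disappears as x → 0.
    have key : ∀ x ∈ Set.Ioo (0 : ℝ) 1, (1 - 2 * p) ^ 2 * (1 - x ^ 2) ≤ s := by
      rintro x ⟨hx0, hx1⟩
      have hxa : |x| < 1 := by rwa [abs_of_pos hx0]
      have hcx : |(1 - 2 * p) * x| < 1 := by
        rw [abs_mul]
        exact (mul_le_of_le_one_left (abs_nonneg _) hc).trans_lt hxa
      have hx2 : 0 < 1 - x ^ 2 := by nlinarith
      have e00 : symmetricPair x (0, 0) = (1 + x) / 4 := by simp [symmetricPair]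
      have e01 : symmetricPair x (0, 1) = (1 - x) / 4 := by
        simp [symmetricPair]
      have e10 : symmetricPair x (1, 0) = (1 - x) / 4 := by
        simp [symmetricPair]
      have e11 : symmetricPair x (1, 1) = (1 + x) / 4 := by simp [symmetricPair]
      have hX : mutualInfo (fun u b => symmetricPair x (u, b)) * log 2 = entropyGap x :=
        mutualInfo_symmetric hxa.le e00 e01 e10 e11
      have hY : mutualInfo (fun u y => ∑ b, symmetricPair x (u, b) * bsc p b y) * log 2
          = entropyGap ((1 - 2 * p) * x) := by
        refine mutualInfo_symmetric hcx.le ?_ ?_ ?_ ?_ <;>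
        · simp only [sum_zmod_two, e00, e01, e10, e11, bsc_zero_zero, bsc_one_one, bsc_zero_one,
            bsc_one_zero]
          ring
      have hgap : 0 < entropyGap x := lt_of_lt_of_le (by positivity) (half_sq_le_entropyGap hxa)
      have hIX : 0 < mutualInfo (fun u b => symmetricPair x (u, b)) :=
        pos_of_mul_pos_left (hX ▸ hgap) log_two_pos.le
      have hle := hs ⟨2, symmetricPair x, ⟨fun v => ?_, ?_⟩, hIX, rfl⟩
      · refine le_trans ?_ hle
        rw [← mul_div_mul_right _ _ log_two_pos.ne', hX, hY, le_div_iff₀ hgap]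
        calc (1 - 2 * p) ^ 2 * (1 - x ^ 2) * entropyGap x
            ≤ (1 - 2 * p) ^ 2 * (1 - x ^ 2) * (x ^ 2 / 2 / (1 - x ^ 2)) := by
              gcongr
              exact entropyGap_le hxa
          _ = ((1 - 2 * p) * x) ^ 2 / 2 := by field_simp
          _ ≤ _ := half_sq_le_entropyGap hcx
      · unfold symmetricPair; split_ifs <;> linarith
      · rw [Fintype.sum_prod_type]
        simp only [sum_zmod_two, Fin.sum_univ_two, e00, e01, e10, e11]
        ring
    have hmem : (0 : ℝ) ∈ closure (Set.Ioo (0 : ℝ) 1) := by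
      rw [closure_Ioo (by norm_num)]; exact ⟨le_rfl, zero_le_one⟩
    have := le_on_closure (f := fun x : ℝ => (1 - 2 * p) ^ 2 * (1 - x ^ 2)) (g := fun _ => s)
      key (by fun_prop) (by fun_prop) hmem
    simpa using this

/-! ### Memoryless extensions, one coordinate at a time -/

lemma sum_fin_cons {α : Type} [Fintype α] {n : ℕ} (f : (Fin (n + 1) → α) → ℝ) :
    ∑ x, f x = ∑ a, ∑ x : Fin n → α, f (Fin.cons a x) := by
  rw [← (Fin.consEquiv fun _ : Fin (n + 1) => α).sum_comp, Fintype.sum_prod_type]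
  rfl

lemma memoryless_cons {α β : Type} {n : ℕ} (W : α → β → ℝ) (a : α) (b : β) (x : Fin n → α)
    (y : Fin n → β) :
    memoryless (n + 1) W (Fin.cons a x) (Fin.cons b y) = W a b * memoryless n W x y := by
  simp [memoryless, Fin.prod_univ_succ]

lemma memoryless_nonneg {α β : Type} {n : ℕ} {W : α → β → ℝ} (hW : ∀ a b, 0 ≤ W a b)
    (x : Fin n → α) (y : Fin n → β) : 0 ≤ memoryless n W x y :=
  prod_nonneg fun _ _ => hW _ _

lemma sum_memoryless {α β : Type} [Fintype β] {W : α → β → ℝ} (hW : ∀ a, ∑ b, W a b = 1) :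
    ∀ (n : ℕ) (x : Fin n → α), ∑ y, memoryless n W x y = 1
  | 0, x => by simp [memoryless]
  | n + 1, x => by
    rw [sum_fin_cons, ← Fin.cons_self_tail x]
    simp only [memoryless_cons, ← mul_sum, sum_memoryless hW n, mul_one, hW]

lemma sum_negMulLog_memoryless {α β : Type} [Fintype β] {W : α → β → ℝ} {H : ℝ}
    (hW : ∀ a, ∑ b, W a b = 1) (hH : ∀ a, ∑ b, negMulLog (W a b) = H) :
    ∀ (n : ℕ) (x : Fin n → α), ∑ y, negMulLog (memoryless n W x y) = n * H
  | 0, x => by simp [memoryless]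
  | n + 1, x => by
    rw [sum_fin_cons, ← Fin.cons_self_tail x]
    simp only [memoryless_cons, negMulLog_mul, sum_add_distrib, ← mul_sum, ← sum_mul,
      sum_memoryless hW n, sum_negMulLog_memoryless hW hH n, hW, hH]
    push_cast
    ring

lemma output_memoryless_cons {α β : Type} [Fintype α] {n : ℕ} (W : α → β → ℝ)
    (P : (Fin (n + 1) → α) → ℝ) (b : β) (y : Fin n → β) :
    output (memoryless (n + 1) W) P (Fin.cons b y)
      = ∑ a, output (memoryless n W) (fun x => P (Fin.cons a x)) y * W a b := by
  simp only [output, sum_fin_cons, memoryless_cons, sum_mul]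
  exact sum_congr rfl fun a _ => sum_congr rfl fun x _ => by ring

lemma output_sum_mul {ι α β : Type} [Fintype ι] [Fintype α] (V : α → β → ℝ) (P : ι → α → ℝ)
    (w : ι → ℝ) (y : β) :
    output V (fun x => ∑ a, P a x * w a) y = ∑ a, output V (P a) y * w a := by
  simp only [output, sum_mul]
  rw [sum_comm]
  exact sum_congr rfl fun a _ => sum_congr rfl fun x _ => by ring

lemma output_nonneg {α β : Type} [Fintype α] {V : α → β → ℝ} (hV : ∀ x y, 0 ≤ V x y)
    {P : α → ℝ} (hP : ∀ x, 0 ≤ P x) (y : β) : 0 ≤ output V P y :=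
  sum_nonneg fun x _ => mul_nonneg (hP x) (hV x y)

lemma abs_output_le {α β : Type} [Fintype α] {V : α → β → ℝ} (hV : ∀ x y, 0 ≤ V x y)
    {F G : α → ℝ} (hFG : ∀ x, |F x| ≤ G x) (y : β) : |output V F y| ≤ output V G y := by
  refine (abs_sum_le_sum_abs _ _).trans (sum_le_sum fun x _ => ?_)
  rw [abs_mul, abs_of_nonneg (hV x y)]
  exact mul_le_mul_of_nonneg_right (hFG x) (hV x y)

lemma output_add {α β : Type} [Fintype α] (V : α → β → ℝ) (F G : α → ℝ) (y : β) :
    output V (fun x => F x + G x) y = output V F y + output V G y := by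
  simp only [output, add_mul, sum_add_distrib]

lemma output_sub {α β : Type} [Fintype α] (V : α → β → ℝ) (F G : α → ℝ) (y : β) :
    output V (fun x => F x - G x) y = output V F y - output V G y := by
  simp only [output, sub_mul, sum_sub_distrib]

lemma sum_output {α β : Type} [Fintype α] [Fintype β] {V : α → β → ℝ}
    (hV : ∀ x, ∑ y, V x y = 1) (P : α → ℝ) : ∑ y, output V P y = ∑ x, P x := by
  simp only [output]
  rw [sum_comm]
  simp only [← mul_sum, hV, mul_one]

/-! ### Comparison of chi-square functionals -/

/-- The chi-square functional `∑ y, (W F y)² / (W G y)` of the channel `W`. -/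
def chiSq {α β : Type} [Fintype α] [Fintype β] (W : α → β → ℝ) (F G : α → ℝ) : ℝ :=
  ∑ y, output W F y ^ 2 / output W G y

/-- Both sides equal (f+g)²/(a+b) plus (1-2p)² (fb-ga)²/(a+b) over a product of two masses. That
product is ab for the BEC and ab + p(1-p)(a-b)² for the BSC. -/
lemma chiSq_bsc_le_bec_aux {p e f g a b : ℝ} (hp : p ∈ Set.Icc (0 : ℝ) 1)
    (he : 1 - e = (1 - 2 * p) ^ 2) (hf : |f| ≤ a) (hg : |g| ≤ b) :
    (f * (1 - p) + g * p) ^ 2 / (a * (1 - p) + b * p)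
        + (f * p + g * (1 - p)) ^ 2 / (a * p + b * (1 - p))
      ≤ (f * e + g * e) ^ 2 / (a * e + b * e)
        + ((f * (1 - e)) ^ 2 / (a * (1 - e)) + (g * (1 - e)) ^ 2 / (b * (1 - e))) := by
  obtain ⟨hp0, hp1⟩ := hp
  have hsc : ∀ x y k : ℝ, (x * k) ^ 2 / (y * k) = k * (x ^ 2 / y) := by
    intro x y k
    rcases eq_or_ne k 0 with h | h
    · simp [h]
    · rw [mul_pow, sq k, ← mul_assoc, mul_div_mul_right _ _ h]; ring
  -- A zero mass forces a zero numerator, and the two sides then coincide.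
  rcases eq_or_lt_of_le ((abs_nonneg f).trans hf) with ha | ha
  · have hf0 : f = 0 := abs_nonpos_iff.1 (ha ▸ hf)
    subst hf0
    simp only [← ha, zero_mul, zero_add, hsc]
    simp
    exact le_of_eq (by ring)
  rcases eq_or_lt_of_le ((abs_nonneg g).trans hg) with hb | hb
  · have hg0 : g = 0 := abs_nonpos_iff.1 (hb ▸ hg)
    subst hg0
    simp only [← hb, zero_mul, add_zero, hsc]
    simp
    exact le_of_eq (by ring)
  rw [← add_mul, ← add_mul, hsc, hsc, hsc, he, show e = 1 - (1 - 2 * p) ^ 2 by linarith]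
  have hq : 0 ≤ 1 - p := by linarith
  have d1 : 0 < a * (1 - p) + b * p := by
    rcases eq_or_lt_of_le hp0 with h | h
    · rw [← h]; simpa using ha
    · have := mul_pos hb h; have := mul_nonneg ha.le hq; linarith
  have d2 : 0 < a * p + b * (1 - p) := by
    rcases eq_or_lt_of_le hp0 with h | h
    · rw [← h]; simpa using hb
    · have := mul_pos ha h; have := mul_nonneg hb.le hq; linarith
  have e1 : (f * (1 - p) + g * p) ^ 2 / (a * (1 - p) + b * p)
        + (f * p + g * (1 - p)) ^ 2 / (a * p + b * (1 - p))
      = (f + g) ^ 2 / (a + b) + (1 - 2 * p) ^ 2 * ((f * b - g * a) ^ 2 / (a + b)) /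
        ((a * (1 - p) + b * p) * (a * p + b * (1 - p))) := by
    have hab : a + b ≠ 0 := (add_pos ha hb).ne'
    generalize hX : a * (1 - p) + b * p = X at d1
    generalize hY : a * p + b * (1 - p) = Y at d2
    field_simp
    subst hX hY
    ring
  have e2 : f ^ 2 / a + g ^ 2 / b
      = (f + g) ^ 2 / (a + b) + (f * b - g * a) ^ 2 / (a + b) / (a * b) := by
    field_simp
    ring
  have hden : a * b ≤ (a * (1 - p) + b * p) * (a * p + b * (1 - p)) := by
    have : (a * (1 - p) + b * p) * (a * p + b * (1 - p)) - a * b = p * (1 - p) * (a - b) ^ 2 := by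
      ring
    have := mul_nonneg (mul_nonneg hp0 hq) (sq_nonneg (a - b))
    linarith
  have hle : (1 - 2 * p) ^ 2 * ((f * b - g * a) ^ 2 / (a + b)) /
        ((a * (1 - p) + b * p) * (a * p + b * (1 - p)))
      ≤ (1 - 2 * p) ^ 2 * ((f * b - g * a) ^ 2 / (a + b)) / (a * b) := by
    gcongr
  rw [e1, ← mul_add, e2]
  rw [mul_div_assoc (b := (f * b - g * a) ^ 2 / (a + b)) (c := a * b)] at hle
  linarith

/-- The BEC with the same chi-square contraction dominates the BSC. -/
lemma chiSq_bsc_le_bec {p e : ℝ} (hp : p ∈ Set.Icc (0 : ℝ) 1) (he : e ∈ Set.Icc (0 : ℝ) 1)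
    (hpe : 1 - e = (1 - 2 * p) ^ 2) :
    ∀ (n : ℕ) (F G : (Fin n → ZMod 2) → ℝ), (∀ x, |F x| ≤ G x) →
      chiSq (memoryless n (bsc p)) F G ≤ chiSq (memoryless n (bec e)) F G
  | 0, F, G, _ => by simp [chiSq, output, memoryless]
  | n + 1, F, G, hFG => by
    have hbsc : chiSq (memoryless (n + 1) (bsc p)) F G
        = ∑ b, chiSq (memoryless n (bsc p)) (fun x => ∑ a, F (Fin.cons a x) * bsc p a b)
            (fun x => ∑ a, G (Fin.cons a x) * bsc p a b) := by
      simp only [chiSq, sum_fin_cons, output_memoryless_cons]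
      refine sum_congr rfl fun b _ => sum_congr rfl fun y _ => ?_
      rw [← output_sum_mul (P := fun a x => F (Fin.cons a x)),
        ← output_sum_mul (P := fun a x => G (Fin.cons a x))]
    -- Hybrid argument: the tail is switched to the BEC for each fixed first output, then the first
    -- coordinate is switched for each fixed tail output.
    have hstep : ∀ b, chiSq (memoryless n (bsc p)) (fun x => ∑ a, F (Fin.cons a x) * bsc p a b)
            (fun x => ∑ a, G (Fin.cons a x) * bsc p a b)
        ≤ chiSq (memoryless n (bec e)) (fun x => ∑ a, F (Fin.cons a x) * bsc p a b)
            (fun x => ∑ a, G (Fin.cons a x) * bsc p a b) := by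
      refine fun b => chiSq_bsc_le_bec hp he hpe n _ _ fun x => ?_
      exact abs_output_le (bsc_nonneg hp) (fun a => hFG (Fin.cons a x)) b
    rw [hbsc]
    refine (sum_le_sum fun b _ => hstep b).trans ?_
    simp only [chiSq, sum_fin_cons (fun y => output (memoryless (n + 1) (bec e)) F y ^ 2 /
      output (memoryless (n + 1) (bec e)) G y), output_memoryless_cons]
    rw [sum_comm, sum_comm (s := (univ : Finset (Option (ZMod 2))))]
    refine sum_le_sum fun y _ => ?_
    simp only [output_sum_mul (P := fun a x => F (Fin.cons a x)),
      output_sum_mul (P := fun a x => G (Fin.cons a x))]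
    rw [Fintype.sum_option]
    simp only [sum_zmod_two, bsc_zero_zero, bsc_one_one, bsc_zero_one, bsc_one_zero, bec_none,
      bec_zero_zero, bec_one_one, bec_zero_one, bec_one_zero, mul_zero, zero_add, add_zero]
    exact chiSq_bsc_le_bec_aux hp hpe
      (abs_output_le (memoryless_nonneg (bec_nonneg he)) (fun x => hFG _) y)
      (abs_output_le (memoryless_nonneg (bec_nonneg he)) (fun x => hFG _) y)

/-! ### Input laws that are uniform on an affine code -/

/-- `P` is invariant under translation by differences of points of its support. -/
def TranslationInvariant {n : ℕ} (P : (Fin n → ZMod 2) → ℝ) : Prop :=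
  ∀ x x', P x ≠ 0 → P x' ≠ 0 → ∀ z, P (z + x - x') = P z

lemma cons_add_sub {n : ℕ} (a b c : ZMod 2) (x y z : Fin n → ZMod 2) :
    (Fin.cons a x + Fin.cons b y - Fin.cons c z : Fin (n + 1) → ZMod 2)
      = Fin.cons (a + b - c) (x + y - z) := by
  funext i
  refine Fin.cases ?_ (fun j => ?_) i <;> simp

/-- Lifting x and x' to the support with first bits b and c, the translation shifts the summed bit
by b - c, which only permutes the sum. The induction on coordinates needs this. -/
lemma TranslationInvariant.tail {n : ℕ} {P : (Fin (n + 1) → ZMod 2) → ℝ}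
    (hP : TranslationInvariant P) :
    TranslationInvariant (fun x : Fin n → ZMod 2 => ∑ a : ZMod 2, P (Fin.cons a x)) := by
  intro x x' hx hx' z
  obtain ⟨b, -, hb⟩ := exists_ne_zero_of_sum_ne_zero hx
  obtain ⟨c, -, hc⟩ := exists_ne_zero_of_sum_ne_zero hx'
  beta_reduce
  rw [← Equiv.sum_comp (Equiv.addRight (b - c))]
  refine sum_congr rfl fun a _ => ?_
  rw [← hP _ _ hb hc (Fin.cons a z), cons_add_sub, Equiv.coe_addRight, add_sub_assoc a]

/-- Through a BEC, a coordinate of an affine code is either known or unbiased given the outputs of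
the other coordinates. -/
lemma TranslationInvariant.bec_trichotomy {n : ℕ} {P : (Fin (n + 1) → ZMod 2) → ℝ}
    (hP : TranslationInvariant P) (e : ℝ) (y : Fin n → Option (ZMod 2)) :
    output (memoryless n (bec e)) (fun x => P (Fin.cons 0 x)) y
        = output (memoryless n (bec e)) (fun x => P (Fin.cons 1 x)) y ∨
      output (memoryless n (bec e)) (fun x => P (Fin.cons 0 x)) y = 0 ∨
      output (memoryless n (bec e)) (fun x => P (Fin.cons 1 x)) y = 0 := by
  by_cases h0 : output (memoryless n (bec e)) (fun x => P (Fin.cons 0 x)) y = 0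
  · exact Or.inr (Or.inl h0)
  by_cases h1 : output (memoryless n (bec e)) (fun x => P (Fin.cons 1 x)) y = 0
  · exact Or.inr (Or.inr h1)
  left
  -- Two support points compatible with y and with first bits 0 and 1: they agree wherever y is not
  -- erased, so translating by their difference preserves the likelihood of y and exchanges the two
  -- sums.
  obtain ⟨x, -, hx⟩ := exists_ne_zero_of_sum_ne_zero h0
  obtain ⟨x', -, hx'⟩ := exists_ne_zero_of_sum_ne_zero h1
  have hrow : ∀ z : Fin n → ZMod 2, memoryless n (bec e) z y ≠ 0 →
      ∀ i b, y i = some b → z i = b := by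
    intro z hz i b hb
    have := prod_ne_zero_iff.1 hz i (mem_univ i)
    rw [hb] at this
    by_contra hne
    exact this (by simp [bec, Ne.symm hne])
  have hM : ∀ z : Fin n → ZMod 2,
      memoryless n (bec e) (z + x - x') y = memoryless n (bec e) z y := by
    intro z
    refine prod_congr rfl fun i _ => ?_
    cases hy : y i with
    | none => rfl
    | some b =>
      rw [Pi.sub_apply, Pi.add_apply, hrow x (right_ne_zero_of_mul hx) i b hy,
        hrow x' (right_ne_zero_of_mul hx') i b hy, add_sub_cancel_right]
  unfold output
  rw [← Equiv.sum_comp (Equiv.addRight (x - x'))]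
  refine sum_congr rfl fun z _ => ?_
  simp only [Equiv.coe_addRight]
  rw [← add_sub_assoc, hM,
    ← hP _ _ (left_ne_zero_of_mul hx) (left_ne_zero_of_mul hx') (Fin.cons 1 z), cons_add_sub,
    show (1 + 0 - 1 : ZMod 2) = 0 by decide]

/-! ### Chain rule -/

/-- With d = (r-s)/(r+s), the BSC output has bias (1-2p)d up to sign, so its entropy gap is at most
d² times that of the channel noise. -/
lemma negMulLog_bsc_ge {p r s : ℝ} (hp : p ∈ Set.Icc (0 : ℝ) 1) (hr : 0 ≤ r) (hs : 0 ≤ s) :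
    negMulLog (r + s) + (r + s) * binEntropy p
        + (log 2 - binEntropy p) * ((r + s) - (r - s) ^ 2 / (r + s))
      ≤ negMulLog (r * (1 - p) + s * p) + negMulLog (r * p + s * (1 - p)) := by
  have h := splitEntropy_bsc hp hr hs
  rw [splitEntropy, show (1 - p) * r + p * s + (p * r + (1 - p) * s) = r + s by ring,
    mul_comm (1 - p) r, mul_comm p s, mul_comm p r, mul_comm (1 - p) s] at h
  rcases eq_or_lt_of_le (add_nonneg hr hs) with h0 | h0
  · simp only [← h0, zero_mul, div_zero] at h ⊢
    rw [negMulLog_zero] at h ⊢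
    linarith
  set d := (r - s) / (r + s) with hd
  have hd1 : |d| ≤ 1 := by
    rw [hd, abs_div, abs_of_pos h0, div_le_one h0]
    exact abs_le.2 ⟨by linarith, by linarith⟩
  have hc : |1 - 2 * p| ≤ 1 := abs_le.2 ⟨by linarith [hp.2], by linarith [hp.1]⟩
  have hgc : entropyGap (1 - 2 * p) = log 2 - binEntropy p := by
    rw [entropyGap, show (1 + (1 - 2 * p)) / 2 = 1 - p by ring, binEntropy_one_sub]
  have hgd : binEntropy (p + (1 - 2 * p) * (s / (r + s)))
      = log 2 - entropyGap ((1 - 2 * p) * d) := by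
    rw [← entropyGap_neg, entropyGap, sub_sub_cancel]
    congr 1
    rw [hd]
    field_simp
    ring
  have hsq : (r - s) ^ 2 / (r + s) = (r + s) * d ^ 2 := by
    rw [hd]; field_simp
  have hkey := mul_le_mul_of_nonneg_left (entropyGap_mul_le hc hd1) h0.le
  rw [hgd] at h
  rw [hgc] at hkey
  rw [hsq]
  linarith

/-- Binary entropy equals log 2 (1 - d²) exactly at the biases d = 0 and d = ±1. -/
lemma splitEntropy_of_trichotomy {r s : ℝ} (h : r = s ∨ r = 0 ∨ s = 0) :
    splitEntropy r s = log 2 * ((r + s) - (r - s) ^ 2 / (r + s)) := by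
  rcases h with rfl | rfl | rfl
  · rw [splitEntropy, ← two_mul r, negMulLog_mul, sub_self]
    simp only [negMulLog]
    ring
  · rcases eq_or_ne s 0 with rfl | h
    · simp [splitEntropy]
    · have : s ^ 2 / s = s := by field_simp
      simp [splitEntropy, this]
  · rcases eq_or_ne r 0 with rfl | h
    · simp [splitEntropy]
    · have : r ^ 2 / r = r := by field_simp
      simp [splitEntropy, this]

/-- For an input law uniform on an affine code, the information through the BEC is proportional to
an exponent `K` for which the information through the BSC is at least `K` times its capacity. -/
lemma exists_information_exponent {p e : ℝ} (hp : p ∈ Set.Icc (0 : ℝ) 1)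
    (he : e ∈ Set.Icc (0 : ℝ) 1) (hpe : 1 - e = (1 - 2 * p) ^ 2) :
    ∀ (n : ℕ) (P : (Fin n → ZMod 2) → ℝ), P ∈ stdSimplex ℝ (Fin n → ZMod 2) →
      TranslationInvariant P → ∃ K : ℝ,
        (log 2 - binEntropy p) * K
            ≤ ∑ y, negMulLog (output (memoryless n (bsc p)) P y) - n * binEntropy p ∧
          ∑ y, negMulLog (output (memoryless n (bec e)) P y) - n * binEntropy e
            = (1 - e) * K * log 2
  | 0, P, hP, _ => by
    have h1 : ∑ x, P x = 1 := hP.2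
    exact ⟨0, by simp [output, memoryless, -univ_unique, h1],
      by simp [output, memoryless, -univ_unique, h1]⟩
  | n + 1, P, hP, hT => by
    set P' : (Fin n → ZMod 2) → ℝ := fun x => ∑ a : ZMod 2, P (Fin.cons a x) with hP'
    set F : (Fin n → ZMod 2) → ℝ := fun x => P (Fin.cons 0 x) - P (Fin.cons 1 x) with hF
    have hP'1 : ∑ x, P' x = 1 := by
      rw [hP', sum_comm, ← sum_fin_cons]; exact hP.2
    have hP'mem : P' ∈ stdSimplex ℝ (Fin n → ZMod 2) :=
      ⟨fun x => sum_nonneg fun a _ => hP.1 _, hP'1⟩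
    have hP'2 : P' = fun x => P (Fin.cons 0 x) + P (Fin.cons 1 x) :=
      funext fun x => sum_zmod_two _
    have hFP : ∀ x, |F x| ≤ P' x := by
      intro x
      rw [hP'2]
      have h0 := hP.1 (Fin.cons 0 x)
      have h1 := hP.1 (Fin.cons 1 x)
      exact abs_le.2 ⟨by simp only [hF]; linarith, by simp only [hF]; linarith⟩
    obtain ⟨K, hK1, hK2⟩ := exists_information_exponent hp he hpe n P' hP'mem hT.tail
    have hchi := chiSq_bsc_le_bec hp he hpe n F P' hFP
    have hD : 0 ≤ log 2 - binEntropy p := sub_nonneg.2 binEntropy_le_log_two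
    have hadd : ∀ {β : Type} (V : (Fin n → ZMod 2) → β → ℝ) (y : β),
        output V (fun x => P (Fin.cons 0 x)) y + output V (fun x => P (Fin.cons 1 x)) y
          = output V P' y := fun V y => by rw [hP'2, output_add]
    have hsub : ∀ {β : Type} (V : (Fin n → ZMod 2) → β → ℝ) (y : β),
        output V (fun x => P (Fin.cons 0 x)) y - output V (fun x => P (Fin.cons 1 x)) y
          = output V F y := fun V y => by rw [hF, output_sub]
    -- The increment is 1 - E d² for the first bit seen behind the BEC: exact for the BEC, and for
    -- the BSC a lower bound through `hchi`.
    refine ⟨K + (1 - chiSq (memoryless n (bec e)) F P'), ?_, ?_⟩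
    · have hge : ∑ y, negMulLog (output (memoryless n (bsc p)) P' y) + binEntropy p
          + (log 2 - binEntropy p) * (1 - chiSq (memoryless n (bsc p)) F P')
          ≤ ∑ y, negMulLog (output (memoryless (n + 1) (bsc p)) P y) := by
        have h1 : ∑ y, output (memoryless n (bsc p)) P' y = 1 := by
          rw [sum_output (sum_memoryless (sum_bsc_row p) n), hP'1]
        calc _ = ∑ y, (negMulLog (output (memoryless n (bsc p)) P' y)
                + output (memoryless n (bsc p)) P' y * binEntropy p
                + (log 2 - binEntropy p) * (output (memoryless n (bsc p)) P' y
                  - output (memoryless n (bsc p)) F y ^ 2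
                    / output (memoryless n (bsc p)) P' y)) := by
              simp only [sum_add_distrib, ← sum_mul, ← mul_sum, sum_sub_distrib, h1, chiSq, one_mul]
          _ ≤ _ := by
              rw [sum_fin_cons, sum_comm]
              refine sum_le_sum fun y _ => ?_
              simp only [output_memoryless_cons, sum_zmod_two, bsc_zero_zero, bsc_one_one,
                bsc_zero_one, bsc_one_zero]
              rw [← hadd, ← hsub]
              exact negMulLog_bsc_ge hp
                (output_nonneg (memoryless_nonneg (bsc_nonneg hp)) (fun x => hP.1 _) y)
                (output_nonneg (memoryless_nonneg (bsc_nonneg hp)) (fun x => hP.1 _) y)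
      have := mul_le_mul_of_nonneg_left hchi hD
      push_cast
      linarith
    · have heq : ∑ y, negMulLog (output (memoryless (n + 1) (bec e)) P y)
          = ∑ y, negMulLog (output (memoryless n (bec e)) P' y) + binEntropy e
          + (1 - e) * (log 2 * (1 - chiSq (memoryless n (bec e)) F P')) := by
        have h1 : ∑ y, output (memoryless n (bec e)) P' y = 1 := by
          rw [sum_output (sum_memoryless (sum_bec_row e) n), hP'1]
        calc _ = ∑ y, (negMulLog (output (memoryless n (bec e)) P' y)
                + output (memoryless n (bec e)) P' y * binEntropy e
                + (1 - e) * (log 2 * (output (memoryless n (bec e)) P' y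
                  - output (memoryless n (bec e)) F y ^ 2
                    / output (memoryless n (bec e)) P' y))) := by
              rw [sum_fin_cons, sum_comm]
              refine sum_congr rfl fun y _ => ?_
              rw [Fintype.sum_option]
              simp only [output_memoryless_cons, sum_zmod_two, bec_none, bec_zero_zero,
                bec_one_one, bec_zero_one, bec_one_zero, mul_zero, zero_add, add_zero]
              rw [← hadd, ← hsub, ← splitEntropy_of_trichotomy (hT.bec_trichotomy e y),
                ← splitEntropy_bec]
              ring_nf
          _ = _ := by
              simp only [sum_add_distrib, ← sum_mul, ← mul_sum, sum_sub_distrib, h1, chiSq, one_mul]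
      rw [heq]
      push_cast
      linarith

-- Uniform laws on shifted codes, and the theorem

lemma uniformOn_mem_stdSimplex {α : Type} [Fintype α] {S : Set α} (hS : S.Nonempty) :
    uniformOn S ∈ stdSimplex ℝ α := by
  classical
  refine ⟨fun x => Set.indicator_nonneg (fun _ _ => by positivity) x, ?_⟩
  have hcard : (S.ncard : ℝ) ≠ 0 := by
    have := (Set.ncard_pos S.toFinite).2 hS
    positivity
  have hsum : ∑ x, uniformOn S x = (S.ncard : ℝ) * (1 / S.ncard) := by
    simp only [uniformOn, Set.indicator_apply]
    rw [← sum_filter, sum_const, nsmul_eq_mul, Set.ncard_eq_toFinset_card', ← Set.toFinset_ofPred]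
    simp
  rw [hsum, mul_one_div_cancel hcard]

lemma translationInvariant_uniformOn_shiftedCode {n : ℕ}
    (C : Submodule (ZMod 2) (Fin n → ZMod 2)) (u : Fin n → ZMod 2) :
    TranslationInvariant (uniformOn (shiftedCode C u)) := by
  have hmem : ∀ z, z ∈ shiftedCode C u ↔ z - u ∈ C := by
    intro z
    refine ⟨?_, fun h => ⟨z - u, h, sub_add_cancel z u⟩⟩
    rintro ⟨c, hc, rfl⟩
    simpa using hc
  intro x x' hx hx' z
  have hx := (hmem x).1 (Set.mem_of_indicator_ne_zero hx)
  have hx' := (hmem x').1 (Set.mem_of_indicator_ne_zero hx')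
  have hiff : z + x - x' ∈ shiftedCode C u ↔ z ∈ shiftedCode C u := by
    rw [hmem, hmem, show z + x - x' - u = (z - u) + ((x - u) - (x' - u)) by abel]
    exact C.add_mem_iff_left (C.sub_mem hx hx')
  classical
  simp only [uniformOn, Set.indicator_apply, hiff]

end CodeInfo
end

theorem theorem1 (n : ℕ) (C : Submodule (ZMod 2) (Fin n → ZMod 2)) (u : Fin n → ZMod 2)
    (t : ℝ) (ht : t ∈ Set.Icc (0 : ℝ) 1)
    (p : ℝ) (hp : p ∈ Set.Icc (0 : ℝ) 1) (hBSC : CodeInfo.HasCapacity (CodeInfo.bsc p) t)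
    (e : ℝ) (he : e ∈ Set.Icc (0 : ℝ) 1)
    (hBEC : CodeInfo.HasCapacity (CodeInfo.bec e) (CodeInfo.eta t)) :
    CodeInfo.IsSDPICoeff (CodeInfo.bsc p) (CodeInfo.eta t) ∧
    CodeInfo.channelInfo (CodeInfo.uniformOn (CodeInfo.shiftedCode C u))
        (CodeInfo.memoryless n (CodeInfo.bsc p)) ≥
      t * (CodeInfo.channelInfo (CodeInfo.uniformOn (CodeInfo.shiftedCode C u))
        (CodeInfo.memoryless n (CodeInfo.bec e)) / CodeInfo.eta t) ∧
    t * (CodeInfo.channelInfo (CodeInfo.uniformOn (CodeInfo.shiftedCode C u))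
        (CodeInfo.memoryless n (CodeInfo.bec e)) / CodeInfo.eta t) =
      CodeInfo.alpha t * CodeInfo.channelInfo (CodeInfo.uniformOn (CodeInfo.shiftedCode C u))
        (CodeInfo.memoryless n (CodeInfo.bec e)) := by
  open CodeInfo in
  have htp := capacity_bsc hp hBSC
  have heta := eta_eq_of_capacity hp htp
  have hpe : 1 - e = (1 - 2 * p) ^ 2 := by rw [← heta, capacity_bec he hBEC]
  have hP : uniformOn (shiftedCode C u) ∈ stdSimplex ℝ (Fin n → ZMod 2) :=
    uniformOn_mem_stdSimplex ⟨0 + u, 0, C.zero_mem, rfl⟩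
  refine ⟨heta ▸ isSDPICoeff_bsc hp, ?_, ?_⟩
  · obtain ⟨K, hK1, hK2⟩ := exists_information_exponent hp he hpe n _ hP
      (translationInvariant_uniformOn_shiftedCode C u)
    rw [← channelInfo_mul_log_two hP (memoryless_nonneg (bsc_nonneg hp))
      (sum_memoryless (sum_bsc_row p) n)
      (sum_negMulLog_memoryless (sum_bsc_row p) (sum_negMulLog_bsc p) n), ← htp] at hK1
    rw [← channelInfo_mul_log_two hP (memoryless_nonneg (bec_nonneg he))
      (sum_memoryless (sum_bec_row e) n)
      (sum_negMulLog_memoryless (sum_bec_row e) (sum_negMulLog_bec e) n)] at hK2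
    have hE := mul_right_cancel₀ log_two_pos.ne' hK2
    have hB : t * K ≤ channelInfo (uniformOn (shiftedCode C u)) (memoryless n (bsc p)) := by
      refine le_of_mul_le_mul_right ?_ log_two_pos
      linarith
    refine le_trans (le_of_eq ?_) hB
    rw [hE, hpe, ← heta]
    -- If η vanishes then p = 1/2 and t = 0, so both sides are 0.
    rcases eq_or_ne (eta t) 0 with h0 | h0
    · have hp2 : p = 2⁻¹ := by
        have := pow_eq_zero_iff two_ne_zero |>.1 (heta ▸ h0)
        linarith
      have ht0 : t = 0 := by
        rw [hp2, Real.binEntropy_two_inv, sub_self] at htp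
        exact (mul_eq_zero.1 htp).resolve_right log_two_pos.ne'
      simp [ht0]
    · rw [mul_div_cancel_left₀ _ h0]
  · rw [alpha]
    ring
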